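/- Let $K$ be an algebraically closed field, $n\ge 0$, $S=K[y_0,\dots,y_n]$ with its standard grading, and $\mathfrak M=(y_0,\dots,y_n)$. A homogeneous ideal $\mathfrak J\subseteq S$ is saturated if, for every $g\in S$, $g\,\mathfrak M^t\subseteq\mathfrak J$ for some $t\in\mathbb N$ implies $g\in\mathfrak J$; the saturation $\mathfrak J^{sat}$ of a homogeneous ideal $\mathfrak J$ is the smallest saturated ideal containing it. The Hilbert polynomial of $S/\mathfrak J$ is the polynomial $P\in\mathbb Q[X]$ with $P(d)=\dim_K(S/\mathfrak J)_d$ for all large $d$. For a nonzero linear form $z\in S$, a dehomogenization with respect to $z$ is a map $\pi:S\to K[x_1,\dots,x_n]$ consisting of a $K$-linear change of coordinates of $S$ carrying $z$ to $y_0$, followed by the substitution $F(y_0,\dots,y_n)\mapsto F(1,x_1,\dots,x_n)$; the corresponding dehomogenization of an ideal $\mathfrak J$ is the ideal $\mathfrak J_*=\pi(\mathfrak J)$. Let $\mathfrak H\subseteq S$ be a homogeneous ideal such that $\mathfrak H^{sat}\subsetneq\mathfrak M$, let $f\in\mathfrak M$ be a form, and let $\mathfrak I=\mathfrak H+(f)$.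 Then the following conditions are equivalent: (i) there exists $t\in\mathbb N$ such that $f\,\mathfrak M^t\subseteq\mathfrak H$; (i') $f\in\mathfrak H^{sat}$; (ii) $S/\mathfrak I$ and $S/\mathfrak H$ have the same Hilbert polynomial; (iii) there exist a nonzero linear form $z\in S$ that is a non-zero-divisor on $S/\mathfrak H^{sat}$ and a dehomogenization with respect to $z$ for which $\mathfrak H_*=\mathfrak I_*$; (iv) $\mathfrak H_*=\mathfrak I_*$ for every dehomogenization with respect to every nonzero linear form $z\in S$. -/

import Mathlib

open MvPolynomial

namespace Inessential

/-- The coordinate ring `S = K[y_0, ..., y_n]` of projective `n`-space over `K`. -/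
abbrev CoordRing (K : Type*) [Field K] (n : ℕ) : Type _ := MvPolynomial (Fin (n + 1)) K

/-- The irrelevant ideal `M = (y_0, ..., y_n)`. -/
noncomputable def irrelevantIdeal (K : Type*) [Field K] (n : ℕ) : Ideal (CoordRing K n) :=
  Ideal.span (Set.range X)

/-- `J` is a homogeneous ideal for the standard grading of `S`. -/
def IsHomogeneousIdeal {K : Type*} [Field K] {n : ℕ} (J : Ideal (CoordRing K n)) : Prop :=
  letI : GradedAlgebra (homogeneousSubmodule (Fin (n + 1)) K) := MvPolynomial.gradedAlgebra
  J.IsHomogeneous (homogeneousSubmodule (Fin (n + 1)) K)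

/-- A homogeneous ideal `J` is saturated if `f M^t ⊆ J` for some `t` implies `f ∈ J`. -/
def IsSaturatedIdeal {K : Type*} [Field K] {n : ℕ} (J : Ideal (CoordRing K n)) : Prop :=
  IsHomogeneousIdeal J ∧
    ∀ f : CoordRing K n, (∃ t : ℕ, ∀ g ∈ irrelevantIdeal K n ^ t, f * g ∈ J) → f ∈ J

/-- The saturation of `J`: the minimum saturated ideal containing `J`, obtained as the intersection
of all of them. -/
noncomputable def saturation {K : Type*} [Field K] {n : ℕ} (J : Ideal (CoordRing K n)) :
    Ideal (CoordRing K n) :=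
  sInf {J' | IsSaturatedIdeal J' ∧ J ≤ J'}

/-- The Hilbert function `d ↦ dim_K (S/J)_d`, where `(S/J)_d` is the image in `S/J` of the space of
forms of degree `d`. -/
noncomputable def hilbertFunction {K : Type*} [Field K] {n : ℕ} (J : Ideal (CoordRing K n))
    (d : ℕ) : ℕ :=
  Module.finrank K
    ((homogeneousSubmodule (Fin (n + 1)) K d).map (Ideal.Quotient.mkₐ K J).toLinearMap)

/-- `P` is the Hilbert polynomial of `S/J`: `P(d) = dim_K (S/J)_d` for all large `d`
(this determines `P`). -/
def IsHilbertPolynomial {K : Type*} [Field K] {n : ℕ} (J : Ideal (CoordRing K n))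
    (P : Polynomial ℚ) : Prop :=
  ∃ d₀ : ℕ, ∀ d : ℕ, d₀ ≤ d → P.eval (d : ℚ) = (hilbertFunction J d : ℚ)

/-- The dehomogenization `F(y_0, ..., y_n) ↦ F(1, x_1, ..., x_n)` with respect to `y_0`. -/
noncomputable def dehomogenizeZero (K : Type*) [Field K] (n : ℕ) :
    CoordRing K n →ₐ[K] MvPolynomial (Fin n) K :=
  aeval (Fin.cons 1 X)

/-- `π : S → K[x_1, ..., x_n]` is a dehomogenization with respect to the linear form `z`: a linear
change of coordinates `φ` carrying `z` to `y_0`, followed by setting `y_0 = 1`. The dehomogenized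
ideal `J_*` is the image `J.map π` (an ideal, as `π` is surjective). -/
def IsDehomogenization {K : Type*} [Field K] {n : ℕ} (z : CoordRing K n)
    (π : CoordRing K n →ₐ[K] MvPolynomial (Fin n) K) : Prop :=
  ∃ φ : CoordRing K n ≃ₐ[K] CoordRing K n,
    (∀ i, (φ (X i)).IsHomogeneous 1) ∧ φ z = X 0 ∧
      π = (dehomogenizeZero K n).comp φ.toAlgHom

end Inessential

/-! By noetherianity the chain `H : M ^ t` stabilizes, and its last term is the saturation; this
gives (i) ⇔ (i'). The kernel of `S/H → S/I` in degree `d + e`, with `e = deg f`, is the image of `f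
* S_d`. It vanishes for all large `d` exactly when some `M ^ t` multiplies `f` into `H`, which is
(ii). Since (ii) asserts that a polynomial exists, Hilbert's theorem is proved too
(`exists_isHilbertPolynomial`). As `π z = 1`, applying `π` to `f * z ^ t ∈ H` gives (iv). Prime
avoidance over the infinite field `K` supplies a regular linear form for (iii). Conversely,
rehomogenizing `π f ∈ H_*` gives `z ^ k * f ∈ H` (`exists_pow_mul_mem`), and `z` cancels modulo the
saturation. -/

namespace Inessential

/-! ### Homogeneous ideals and powers of the irrelevant ideal. -/

section Homogeneous

variable {K : Type*} [Field K] {n : ℕ}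

theorem isHomogeneousIdeal_iff {J : Ideal (CoordRing K n)} :
    IsHomogeneousIdeal J ↔ ∀ f ∈ J, ∀ d, homogeneousComponent d f ∈ J := by
  constructor
  · intro h f hf d
    exact homogeneousComponent_mem_of_mem h hf d
  · intro h d f hf
    have := h f hf d
    rwa [← decomposition.decompose'_apply] at this

theorem homogeneousComponent_mul_of_isHomogeneous {σ R : Type*} [CommSemiring R]
    {p : MvPolynomial σ R} {e : ℕ} (hp : p.IsHomogeneous e) (g : MvPolynomial σ R) (d : ℕ) :
    homogeneousComponent (d + e) (g * p) = homogeneousComponent d g * p := by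
  induction g using MvPolynomial.induction_on' with
  | monomial u a =>
    have h := isHomogeneous_monomial (σ := σ) a (rfl : u.degree = u.degree)
    rw [homogeneousComponent_of_mem (h.mul hp), homogeneousComponent_of_mem h]
    by_cases hd : d = u.degree <;> simp [hd]
  | add p q hp hq => simp only [add_mul, map_add, hp, hq]

theorem irrelevantIdeal_eq_idealOfVars : irrelevantIdeal K n = idealOfVars (Fin (n + 1)) K := rfl

theorem mem_irrelevantIdeal_pow_of_isHomogeneous {p : CoordRing K n} {d t : ℕ}
    (hp : p.IsHomogeneous d) (h : t ≤ d) : p ∈ irrelevantIdeal K n ^ t := by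
  rw [irrelevantIdeal_eq_idealOfVars, mem_pow_idealOfVars_iff']
  intro u hu
  exact hp.coeff_eq_zero (by omega)

theorem forall_mem_irrelevantIdeal_pow_iff {J : Ideal (CoordRing K n)} {f : CoordRing K n}
    {t : ℕ} : (∀ g ∈ irrelevantIdeal K n ^ t, f * g ∈ J) ↔
      ∀ g : CoordRing K n, g.IsHomogeneous t → f * g ∈ J := by
  constructor
  · intro h g hg
    exact h g (mem_irrelevantIdeal_pow_of_isHomogeneous hg le_rfl)
  · intro h
    have : irrelevantIdeal K n ^ t ≤ J.colon {f} := by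
      rw [irrelevantIdeal_eq_idealOfVars, pow_idealOfVars_eq_span, Ideal.span_le]
      rintro _ ⟨u, hu, rfl⟩
      rw [SetLike.mem_coe, Submodule.mem_colon_singleton, smul_eq_mul, mul_comm]
      exact h _ (isHomogeneous_monomial 1 hu)
    intro g hg
    have := this hg
    rwa [Submodule.mem_colon_singleton, smul_eq_mul, mul_comm] at this

theorem IsHomogeneousIdeal.sup_span_singleton {J : Ideal (CoordRing K n)}
    (hJ : IsHomogeneousIdeal J) {f : CoordRing K n} {e : ℕ} (hf : f.IsHomogeneous e) :
    IsHomogeneousIdeal (J ⊔ Ideal.span {f}) := by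
  let : GradedAlgebra (homogeneousSubmodule (Fin (n + 1)) K) := MvPolynomial.gradedAlgebra
  refine Ideal.IsHomogeneous.sup hJ (Ideal.homogeneous_span _ _ ?_)
  rintro _ rfl
  exact ⟨e, hf⟩

theorem IsHomogeneousIdeal.colon_singleton {J : Ideal (CoordRing K n)}
    (hJ : IsHomogeneousIdeal J) {f : CoordRing K n} {e : ℕ} (hf : f.IsHomogeneous e) :
    IsHomogeneousIdeal (J.colon {f}) := by
  rw [isHomogeneousIdeal_iff] at hJ ⊢
  intro g hg d
  rw [Submodule.mem_colon_singleton, smul_eq_mul] at hg ⊢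
  rw [← homogeneousComponent_mul_of_isHomogeneous hf]
  exact hJ _ hg _

/-- A form of degree `d` in `J + (f)` is congruent modulo `J` to a multiple of `f` by a form. -/
theorem exists_sub_mul_mem_of_mem_sup_span {J : Ideal (CoordRing K n)}
    (hJ : IsHomogeneousIdeal J) {f w : CoordRing K n} {d e : ℕ} (hf : f.IsHomogeneous e)
    (hw : w.IsHomogeneous (d + e)) (hwJ : w ∈ J ⊔ Ideal.span {f}) :
    ∃ g : CoordRing K n, g.IsHomogeneous d ∧ w - g * f ∈ J := by
  obtain ⟨h, hh, b, hb, rfl⟩ := Submodule.mem_sup.1 hwJ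
  obtain ⟨a, rfl⟩ := Ideal.mem_span_singleton'.1 hb
  refine ⟨homogeneousComponent d a, homogeneousComponent_isHomogeneous d a, ?_⟩
  rw [← homogeneousComponent_mul_of_isHomogeneous hf, ← homogeneousComponent_eq_self hw, map_add,
    add_sub_cancel_right]
  exact isHomogeneousIdeal_iff.1 hJ _ hh _

end Homogeneous

/-! ### Saturation as a stable colon ideal. -/

section Saturation

variable {K : Type*} [Field K] {n : ℕ}

theorem exists_colon_pow_stable {R : Type*} [CommRing R] [IsNoetherianRing R] (J M : Ideal R) :
    ∃ N : ℕ, ∀ f : R, (∃ t : ℕ, ∀ g ∈ M ^ t, f * g ∈ J) → ∀ g ∈ M ^ N, f * g ∈ J := by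
  let c : ℕ →o Ideal R :=
    { toFun := fun t => J.colon ((M ^ t : Ideal R) : Set R)
      monotone' := fun s t h f hf => by
        rw [Submodule.mem_colon] at hf ⊢
        exact fun g hg => hf g (Ideal.pow_le_pow_right h hg) }
  have hc (t : ℕ) (f : R) : f ∈ c t ↔ ∀ g ∈ M ^ t, f * g ∈ J := Submodule.mem_colon
  obtain ⟨N, hN⟩ := monotone_stabilizes_iff_noetherian.2 ‹IsNoetherianRing R› c
  refine ⟨N, fun f ⟨t, ht⟩ => ?_⟩
  rw [← hc] at ht ⊢
  rcases le_total t N with h | h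
  · exact c.monotone h ht
  · rwa [hN t h]

theorem isSaturatedIdeal_colon_pow {J : Ideal (CoordRing K n)} (hJ : IsHomogeneousIdeal J)
    {N : ℕ} (hN : ∀ f : CoordRing K n, (∃ t : ℕ, ∀ g ∈ irrelevantIdeal K n ^ t, f * g ∈ J) →
      ∀ g ∈ irrelevantIdeal K n ^ N, f * g ∈ J) :
    IsSaturatedIdeal (J.colon ((irrelevantIdeal K n ^ N : Ideal _) : Set (CoordRing K n))) := by
  have hc (f : CoordRing K n) :
      f ∈ J.colon ((irrelevantIdeal K n ^ N : Ideal _) : Set (CoordRing K n)) ↔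
        ∀ g ∈ irrelevantIdeal K n ^ N, f * g ∈ J := Submodule.mem_colon
  constructor
  · rw [isHomogeneousIdeal_iff]
    intro f hf d
    rw [hc, forall_mem_irrelevantIdeal_pow_iff] at hf ⊢
    intro g hg
    rw [← homogeneousComponent_mul_of_isHomogeneous hg]
    exact isHomogeneousIdeal_iff.1 hJ _ (hf g hg) _
  · rintro f ⟨t, ht⟩
    rw [hc]
    -- The exponent `t + N` collapses back to `N` because `N` is uniform in `f`.
    refine hN f ⟨t + N, fun g hg => ?_⟩
    rw [pow_add] at hg
    induction hg using Submodule.mul_induction_on' with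
    | mem_mul_mem a ha b hb =>
      rw [← mul_assoc]
      exact (hc _).1 (ht a ha) b hb
    | add x _ y _ hx hy =>
      rw [mul_add]
      exact J.add_mem hx hy

theorem saturation_eq_colon_pow {J : Ideal (CoordRing K n)} (hJ : IsHomogeneousIdeal J)
    {N : ℕ} (hN : ∀ f : CoordRing K n, (∃ t : ℕ, ∀ g ∈ irrelevantIdeal K n ^ t, f * g ∈ J) →
      ∀ g ∈ irrelevantIdeal K n ^ N, f * g ∈ J) :
    saturation J = J.colon ((irrelevantIdeal K n ^ N : Ideal _) : Set (CoordRing K n)) := by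
  apply le_antisymm
  · refine sInf_le ⟨isSaturatedIdeal_colon_pow hJ hN, fun f hf => ?_⟩
    rw [Submodule.mem_colon]
    exact fun g _ => J.mul_mem_right g hf
  · refine le_sInf fun J' hJ' f hf => hJ'.1.2 f ⟨N, fun g hg => hJ'.2 ?_⟩
    exact Submodule.mem_colon.1 hf g hg

theorem isSaturatedIdeal_saturation {J : Ideal (CoordRing K n)} (hJ : IsHomogeneousIdeal J) :
    IsSaturatedIdeal (saturation J) := by
  obtain ⟨N, hN⟩ := exists_colon_pow_stable J (irrelevantIdeal K n)
  rw [saturation_eq_colon_pow hJ hN]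
  exact isSaturatedIdeal_colon_pow hJ hN

theorem le_saturation (J : Ideal (CoordRing K n)) : J ≤ saturation J :=
  le_sInf fun _ h => h.2

theorem mem_saturation_iff {J : Ideal (CoordRing K n)} (hJ : IsHomogeneousIdeal J)
    {f : CoordRing K n} :
    f ∈ saturation J ↔ ∃ t : ℕ, ∀ g ∈ irrelevantIdeal K n ^ t, f * g ∈ J := by
  obtain ⟨N, hN⟩ := exists_colon_pow_stable J (irrelevantIdeal K n)
  rw [saturation_eq_colon_pow hJ hN]
  exact ⟨fun h => ⟨N, Submodule.mem_colon.1 h⟩, fun h => Submodule.mem_colon.2 (hN f h)⟩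

end Saturation

/-! ### Hilbert functions and Hilbert polynomials. -/

section Hilbert

theorem finrank_map_add_finrank_inf_ker {K E F : Type*} [DivisionRing K] [AddCommGroup E]
    [Module K E] [AddCommGroup F] [Module K F] (W : Submodule K E) [FiniteDimensional K W]
    (p : E →ₗ[K] F) :
    Module.finrank K (W.map p) + Module.finrank K (W ⊓ LinearMap.ker p : Submodule K E) =
      Module.finrank K W := by
  rw [← LinearMap.finrank_range_add_finrank_ker (p.domRestrict W), LinearMap.range_domRestrict,
    LinearMap.ker_domRestrict, ← Submodule.map_comap_subtype,
    (Submodule.equivMapOfInjective W.subtype W.injective_subtype _).finrank_eq]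

theorem finrank_map_eq_of_forall_iff {K E F G : Type*} [DivisionRing K] [AddCommGroup E]
    [Module K E] [AddCommGroup F] [Module K F] [AddCommGroup G] [Module K G]
    (W : Submodule K E) [FiniteDimensional K W] (p : E →ₗ[K] F) (q : E →ₗ[K] G)
    (h : ∀ w ∈ W, p w = 0 ↔ q w = 0) :
    Module.finrank K (W.map p) = Module.finrank K (W.map q) := by
  have hp := finrank_map_add_finrank_inf_ker W p
  have hq := finrank_map_add_finrank_inf_ker W q
  have : W ⊓ LinearMap.ker p = W ⊓ LinearMap.ker q := by
    ext w
    simp only [Submodule.mem_inf, LinearMap.mem_ker]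
    exact and_congr_right (h w)
  rw [this] at hp
  omega

/-- The last term is the dimension of the kernel of the induced surjection `p(W) → q(W)`. -/
theorem finrank_map_eq_add {K E F G : Type*} [DivisionRing K] [AddCommGroup E]
    [Module K E] [AddCommGroup F] [Module K F] [AddCommGroup G] [Module K G]
    (W : Submodule K E) [FiniteDimensional K W] (p : E →ₗ[K] F) (q : E →ₗ[K] G)
    (h : LinearMap.ker p ≤ LinearMap.ker q) :
    Module.finrank K (W.map p) = Module.finrank K (W.map q) +
      Module.finrank K ((W ⊓ LinearMap.ker q).map p) := by
  have hp := finrank_map_add_finrank_inf_ker W p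
  have hq := finrank_map_add_finrank_inf_ker W q
  have : FiniteDimensional K (W ⊓ LinearMap.ker q : Submodule K E) :=
    Submodule.finiteDimensional_inf_left _ _
  have hpq := finrank_map_add_finrank_inf_ker (W ⊓ LinearMap.ker q) p
  rw [inf_assoc, inf_eq_right.2 h] at hpq
  omega

variable {K : Type*} [Field K] {n : ℕ}

instance finiteDimensional_homogeneousSubmodule (d : ℕ) :
    FiniteDimensional K (homogeneousSubmodule (Fin (n + 1)) K d) :=
  Module.Finite.iff_fg.2 (homogeneousSubmodule_fg _ K d)

theorem ker_mkₐ_le {J J' : Ideal (CoordRing K n)} (h : J ≤ J') :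
    LinearMap.ker (Ideal.Quotient.mkₐ K J).toLinearMap ≤
      LinearMap.ker (Ideal.Quotient.mkₐ K J').toLinearMap := by
  intro w hw
  simp only [LinearMap.mem_ker, AlgHom.toLinearMap_apply, Ideal.Quotient.mkₐ_eq_mk,
    Ideal.Quotient.eq_zero_iff_mem] at hw ⊢
  exact h hw

theorem hilbertFunction_congr {J J' : Ideal (CoordRing K n)} {d : ℕ}
    (h : ∀ w : CoordRing K n, w.IsHomogeneous d → (w ∈ J ↔ w ∈ J')) :
    hilbertFunction J d = hilbertFunction J' d := by
  refine finrank_map_eq_of_forall_iff _ _ _ fun w hw => ?_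
  simpa only [AlgHom.toLinearMap_apply, Ideal.Quotient.mkₐ_eq_mk,
    Ideal.Quotient.eq_zero_iff_mem] using h w hw

theorem mem_of_hilbertFunction_eq {J J' : Ideal (CoordRing K n)} (hJ : J ≤ J') {d : ℕ}
    (h : hilbertFunction J d = hilbertFunction J' d) {w : CoordRing K n}
    (hw : w.IsHomogeneous d) (hwJ : w ∈ J') : w ∈ J := by
  have hadd := finrank_map_eq_add (homogeneousSubmodule (Fin (n + 1)) K d) _ _ (ker_mkₐ_le hJ)
  unfold hilbertFunction at h
  rw [h, left_eq_add] at hadd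
  have : FiniteDimensional K (homogeneousSubmodule (Fin (n + 1)) K d ⊓
      LinearMap.ker (Ideal.Quotient.mkₐ K J').toLinearMap : Submodule K (CoordRing K n)) :=
    Submodule.finiteDimensional_inf_left _ _
  rw [Submodule.finrank_eq_zero] at hadd
  have hmem := Submodule.mem_map_of_mem (f := (Ideal.Quotient.mkₐ K J).toLinearMap)
    (Submodule.mem_inf.2 ⟨(mem_homogeneousSubmodule d w).2 hw, show w ∈ LinearMap.ker (Ideal.Quotient.mkₐ K J').toLinearMap from
      Ideal.Quotient.eq_zero_iff_mem.2 hwJ⟩)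
  rw [hadd, Submodule.mem_bot] at hmem
  exact Ideal.Quotient.eq_zero_iff_mem.1 hmem

/-- Dimension count in `0 → (S/(J : y))(-1) → S/J → S/(J + (y)) → 0`, the first map being
multiplication by `y`. -/
theorem hilbertFunction_succ {J : Ideal (CoordRing K n)} (hJ : IsHomogeneousIdeal J)
    {y : CoordRing K n} (hy : y.IsHomogeneous 1) (d : ℕ) :
    hilbertFunction J (d + 1) =
      hilbertFunction (J ⊔ Ideal.span {y}) (d + 1) + hilbertFunction (J.colon {y}) d := by
  have hadd := finrank_map_eq_add (homogeneousSubmodule (Fin (n + 1)) K (d + 1)) _ _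
    (ker_mkₐ_le (le_sup_left : J ≤ J ⊔ Ideal.span {y}))
  unfold hilbertFunction
  rw [hadd, Nat.add_left_cancel_iff]
  trans Module.finrank K ((homogeneousSubmodule (Fin (n + 1)) K d).map
    ((Ideal.Quotient.mkₐ K J).toLinearMap ∘ₗ LinearMap.mulRight K y))
  · refine congrArg (fun V : Submodule K (CoordRing K n ⧸ J) => Module.finrank K V) ?_
    ext v
    constructor
    · rintro ⟨w, hw, rfl⟩
      obtain ⟨hw, hwJ⟩ := Submodule.mem_inf.1 hw
      obtain ⟨g, hg, hgJ⟩ := exists_sub_mul_mem_of_mem_sup_span hJ hy hw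
        (Ideal.Quotient.eq_zero_iff_mem.1 hwJ)
      exact ⟨g, hg, (Ideal.Quotient.eq.2 hgJ).symm⟩
    · rintro ⟨g, hg, rfl⟩
      refine ⟨g * y, Submodule.mem_inf.2 ⟨IsHomogeneous.mul hg hy, ?_⟩, rfl⟩
      exact Ideal.Quotient.eq_zero_iff_mem.2 (Ideal.mem_sup_right
        (Ideal.mul_mem_left _ _ (Ideal.mem_span_singleton_self y)))
  · refine finrank_map_eq_of_forall_iff _ _ _ fun w _ => ?_
    simp only [LinearMap.comp_apply, LinearMap.mulRight_apply, AlgHom.toLinearMap_apply,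
      Ideal.Quotient.mkₐ_eq_mk, Ideal.Quotient.eq_zero_iff_mem, Submodule.mem_colon_singleton,
      smul_eq_mul]

/-- Bernoulli polynomials satisfy `B_{k+1}(x + 1) - B_{k+1}(x) = (k + 1) x ^ k`. -/
theorem exists_polynomial_forward_difference (P : Polynomial ℚ) :
    ∃ Q : Polynomial ℚ, ∀ x : ℚ, Q.eval (x + 1) - Q.eval x = P.eval x := by
  induction P using Polynomial.induction_on' with
  | add p q hp hq =>
    obtain ⟨P, hP⟩ := hp
    obtain ⟨Q, hQ⟩ := hq
    refine ⟨P + Q, fun x => ?_⟩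
    rw [Polynomial.eval_add, Polynomial.eval_add, Polynomial.eval_add, ← hP, ← hQ]
    ring
  | monomial k a =>
    refine ⟨Polynomial.C (a / (k + 1)) * Polynomial.bernoulli (k + 1), fun x => ?_⟩
    simp only [Polynomial.eval_mul, add_comm x 1, Polynomial.bernoulli_eval_one_add,
      Polynomial.eval_C, Polynomial.eval_monomial, Nat.add_sub_cancel]
    have : (k : ℚ) + 1 ≠ 0 := by positivity
    push_cast
    field_simp
    ring

/-- Noetherian induction on `J`, using the exact sequence for a variable outside `J`. -/
theorem exists_isHilbertPolynomial {J : Ideal (CoordRing K n)} (hJ : IsHomogeneousIdeal J) :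
    ∃ P : Polynomial ℚ, IsHilbertPolynomial J P := by
  induction J using WellFoundedGT.induction with
  | ind J ih =>
  by_cases hX : ∀ i, (X i : CoordRing K n) ∈ J
  · refine ⟨0, 1, fun d hd => ?_⟩
    have hMJ : irrelevantIdeal K n ≤ J := Ideal.span_le.2 (Set.range_subset_iff.2 hX)
    have : hilbertFunction J d = 0 := by
      unfold hilbertFunction
      rw [Submodule.finrank_eq_zero, eq_bot_iff]
      rintro _ ⟨w, hw, rfl⟩
      refine Ideal.Quotient.eq_zero_iff_mem.2 (hMJ ?_)
      rw [← pow_one (irrelevantIdeal K n)]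
      exact mem_irrelevantIdeal_pow_of_isHomogeneous hw hd
    simp [this]
  · push Not at hX
    obtain ⟨i, hi⟩ := hX
    have hXi : (X i : CoordRing K n).IsHomogeneous 1 := isHomogeneous_X K i
    obtain ⟨P₁, d₁, h₁⟩ := ih (J ⊔ Ideal.span {X i})
      (left_lt_sup.2 fun h => hi (h (Ideal.mem_span_singleton_self _)))
      (hJ.sup_span_singleton hXi)
    -- If the colon ideal is `J` itself, induction does not apply to it, but the sequence becomes a
    -- difference equation for the Hilbert function of `J`. Otherwise both outer terms come from
    -- strictly larger ideals.
    by_cases hc : J.colon {X i} = J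
    · obtain ⟨Q, hQ⟩ := exists_polynomial_forward_difference
        (P₁.comp (Polynomial.X + Polynomial.C 1))
      -- The constant matches the initial value at `d₁`.
      refine ⟨Q + Polynomial.C ((hilbertFunction J d₁ : ℚ) - Q.eval (d₁ : ℚ)), d₁, fun d hd => ?_⟩
      induction d, hd using Nat.le_induction with
      | base => simp
      | succ d hd hrec =>
        have hs := hilbertFunction_succ hJ hXi d
        rw [hc] at hs
        have hP := h₁ (d + 1) (by omega)
        have hQd := hQ d
        simp only [Polynomial.eval_comp, Polynomial.eval_add, Polynomial.eval_X,
          Polynomial.eval_C] at hQd hrec ⊢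
        rw [hs]
        push_cast at hP ⊢
        linarith
    · have hle : J ≤ J.colon {X i} := fun g hg => by
        rw [Submodule.mem_colon_singleton]
        exact J.mul_mem_right _ hg
      obtain ⟨P₂, d₂, h₂⟩ := ih (J.colon {X i}) (lt_of_le_of_ne hle (Ne.symm hc))
        (hJ.colon_singleton hXi)
      refine ⟨P₁ + P₂.comp (Polynomial.X - Polynomial.C 1), d₁ + d₂ + 1, fun d hd => ?_⟩
      obtain ⟨k, rfl⟩ : ∃ k, d = k + 1 := ⟨d - 1, by omega⟩
      have hs : (hilbertFunction J (k + 1) : ℚ) = _ + _ :=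
        (congrArg _ (hilbertFunction_succ hJ hXi k)).trans (Nat.cast_add _ _)
      rw [hs, ← h₁ (k + 1) (by omega), ← h₂ k (by omega)]
      simp [Polynomial.eval_comp]

/-- In degree at least `t + e` the cofactor of `f` has degree at least `t`, so the multiple of `f`
already lies in `H`. -/
theorem hilbertFunction_sup_span_singleton {H : Ideal (CoordRing K n)}
    (hH : IsHomogeneousIdeal H) {f : CoordRing K n} {e t d : ℕ} (hf : f.IsHomogeneous e)
    (ht : ∀ g ∈ irrelevantIdeal K n ^ t, f * g ∈ H) (hd : t + e ≤ d) :
    hilbertFunction (H ⊔ Ideal.span {f}) d = hilbertFunction H d := by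
  refine hilbertFunction_congr fun w hw => ⟨fun h => ?_, fun h => Ideal.mem_sup_left h⟩
  obtain ⟨k, rfl⟩ : ∃ k, d = k + e := ⟨d - e, by omega⟩
  obtain ⟨g, hg, hgH⟩ := exists_sub_mul_mem_of_mem_sup_span hH hf hw h
  have := ht g (mem_irrelevantIdeal_pow_of_isHomogeneous hg (by omega))
  rw [mul_comm] at this
  simpa using H.add_mem hgH this

theorem exists_isHilbertPolynomial_iff {H : Ideal (CoordRing K n)} (hH : IsHomogeneousIdeal H)
    {f : CoordRing K n} {e : ℕ} (hf : f.IsHomogeneous e) :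
    (∃ P : Polynomial ℚ, IsHilbertPolynomial (H ⊔ Ideal.span {f}) P ∧ IsHilbertPolynomial H P) ↔
      ∃ t : ℕ, ∀ g ∈ irrelevantIdeal K n ^ t, f * g ∈ H := by
  constructor
  · rintro ⟨P, ⟨d₁, h₁⟩, d₂, h₂⟩
    refine ⟨d₁ + d₂, forall_mem_irrelevantIdeal_pow_iff.2 fun g hg => ?_⟩
    refine mem_of_hilbertFunction_eq le_sup_left (d := e + (d₁ + d₂)) ?_ (hf.mul hg)
      (Ideal.mem_sup_right (Ideal.mul_mem_right _ _ (Ideal.mem_span_singleton_self f)))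
    exact_mod_cast (h₂ _ (by omega)).symm.trans (h₁ _ (by omega))
  · rintro ⟨t, ht⟩
    obtain ⟨P, d, hP⟩ := exists_isHilbertPolynomial hH
    refine ⟨P, ⟨d + (t + e), fun k hk => ?_⟩, d, hP⟩
    rw [hilbertFunction_sup_span_singleton hH hf ht (by omega)]
    exact hP k (by omega)

end Hilbert

/-! ### Dehomogenization, rehomogenization and regular linear forms. -/

section Dehomogenization

variable {K : Type*} [Field K] {n : ℕ}

theorem aeval_mul_of_isHomogeneous {σ R A : Type*} [CommSemiring R] [CommSemiring A]
    [Algebra R A] {F : MvPolynomial σ R} {d : ℕ} (hF : F.IsHomogeneous d) (c : A) (v : σ → A) :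
    aeval (fun i => c * v i) F = c ^ d * aeval v F := by
  rw [aeval_def, aeval_def, eval₂_eq, eval₂_eq, Finset.mul_sum]
  refine Finset.sum_congr rfl fun u hu => ?_
  simp only [mul_pow, Finset.prod_mul_distrib, Finset.prod_pow_eq_pow_sum,
    ← hF.degree_eq_sum_deg_support hu]
  ring

/-- In the fraction field, `F(y) = y_0 ^ d * F(1, y_1/y_0, ..., y_n/y_0)`. -/
theorem eq_zero_of_dehomogenizeZero_eq_zero {F : CoordRing K n} {d : ℕ}
    (hF : F.IsHomogeneous d) (h : dehomogenizeZero K n F = 0) : F = 0 := by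
  let y : Fin (n + 1) → FractionRing (CoordRing K n) := fun i =>
    algebraMap (CoordRing K n) _ (X i)
  have hy : y 0 ≠ 0 := by
    simp [y]
  have hcomp : (aeval fun i : Fin n => y i.succ / y 0).comp (dehomogenizeZero K n) =
      aeval fun i => y i / y 0 := by
    refine MvPolynomial.algHom_ext fun i => ?_
    refine Fin.cases ?_ (fun j => ?_) i
    · simp [dehomogenizeZero, hy]
    · simp [dehomogenizeZero]
  have h0 : aeval (fun i => y i / y 0) F = 0 := by
    rw [← hcomp, AlgHom.comp_apply, h, map_zero]
  have h1 := aeval_mul_of_isHomogeneous hF (y 0) (fun i => y i / y 0)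
  simp only [mul_div_cancel₀ _ hy, h0, mul_zero] at h1
  have h2 : aeval y F = algebraMap (CoordRing K n) (FractionRing (CoordRing K n)) F := by
    have := aeval_algebraMap_apply (FractionRing (CoordRing K n)) (X : Fin (n + 1) → CoordRing K n) F
    rwa [aeval_X_left_apply] at this
  have h3 : aeval y F = 0 := by
    convert h1 using 3 with i
  rw [h2] at h3
  simpa using h3

theorem dehomogenizeZero_surjective : Function.Surjective (dehomogenizeZero K n) := by
  intro p
  refine ⟨rename Fin.succ p, ?_⟩
  rw [dehomogenizeZero, aeval_rename]
  exact aeval_X_left_apply p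

namespace IsDehomogenization

variable {z : CoordRing K n} {π : CoordRing K n →ₐ[K] MvPolynomial (Fin n) K}

theorem surjective (hπ : IsDehomogenization z π) : Function.Surjective π := by
  obtain ⟨φ, -, -, rfl⟩ := hπ
  exact dehomogenizeZero_surjective.comp φ.surjective

theorem map_eq_one (hπ : IsDehomogenization z π) : π z = 1 := by
  obtain ⟨φ, -, hz, rfl⟩ := hπ
  change dehomogenizeZero K n (φ z) = 1
  rw [hz]
  simp [dehomogenizeZero]

theorem eq_zero_of_map_eq_zero (hπ : IsDehomogenization z π) {F : CoordRing K n} {d : ℕ}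
    (hF : F.IsHomogeneous d) (h : π F = 0) : F = 0 := by
  obtain ⟨φ, hφ, -, rfl⟩ := hπ
  have hφF : φ F = aeval (fun i => φ (X i)) F :=
    congrArg (· F) (aeval_unique φ.toAlgHom)
  have hhom : (φ F).IsHomogeneous (1 * d) := by
    rw [hφF]
    exact hF.aeval _ hφ
  exact φ.injective ((eq_zero_of_dehomogenizeZero_eq_zero hhom h).trans (map_zero φ).symm)

/-- If `π f` lies in the dehomogenization of `H`, then `z ^ k * f` lies in `H` for some `k`. -/
theorem exists_pow_mul_mem (hπ : IsDehomogenization z π) (hz : z.IsHomogeneous 1)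
    {H : Ideal (CoordRing K n)} (hH : IsHomogeneousIdeal H) {f : CoordRing K n} {e : ℕ}
    (hf : f.IsHomogeneous e) (hfH : π f ∈ H.map π) : ∃ k : ℕ, z ^ k * f ∈ H := by
  obtain ⟨h, hh, hhf⟩ := (Ideal.mem_map_iff_of_surjective π hπ.surjective).1 hfH
  -- `D` bounds both `e` and every degree occurring in `h`, so no subtraction below truncates; `h'`
  -- is `h` homogenized by `z` to degree `D`.
  set D := e + h.totalDegree with hD
  let h' := ∑ i ∈ Finset.range (h.totalDegree + 1), z ^ (D - i) * homogeneousComponent i h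
  have hh' : h' ∈ H := H.sum_mem fun i _ =>
    H.mul_mem_left _ (isHomogeneousIdeal_iff.1 hH h hh i)
  have hhom : h'.IsHomogeneous D := by
    refine IsHomogeneous.sum _ _ _ fun i hi => ?_
    have := (hz.pow (D - i)).mul (homogeneousComponent_isHomogeneous i h)
    rw [Finset.mem_range] at hi
    rwa [show 1 * (D - i) + i = D by omega] at this
  have hfhom : (z ^ (D - e) * f).IsHomogeneous D := by
    have := (hz.pow (D - e)).mul hf
    rwa [show 1 * (D - e) + e = D by omega] at this
  have hπh' : π h' = π h := by
    conv_rhs => rw [← sum_homogeneousComponent h]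
    simp [h', map_sum, hπ.map_eq_one]
  refine ⟨D - e, ?_⟩
  have h0 : z ^ (D - e) * f - h' = 0 := by
    refine hπ.eq_zero_of_map_eq_zero (hfhom.sub hhom) ?_
    rw [map_sub, map_mul, map_pow, hπ.map_eq_one, hπh', hhf]
    simp
  rwa [sub_eq_zero.1 h0]

end IsDehomogenization

theorem exists_linearEquiv_apply_eq {V : Type*} [AddCommGroup V] [Module K V] {a b : V}
    (ha : a ≠ 0) (hb : b ≠ 0) : ∃ A : V ≃ₗ[K] V, A a = b := by
  let ea := LinearEquiv.toSpanNonzeroSingleton K V a ha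
  let eb := LinearEquiv.toSpanNonzeroSingleton K V b hb
  obtain ⟨g, hg⟩ := Submodule.exists_linearEquiv_restrict_eq (ea.symm.trans eb)
  refine ⟨g, ?_⟩
  have := hg (ea 1)
  rw [LinearEquiv.trans_apply, ea.symm_apply_apply] at this
  simpa [ea, eb] using this.symm

/-- A linear automorphism of `K ^ (n + 1)` moving the coefficient vector of `z` to the first basis
vector extends to `S` by substitution. -/
theorem exists_isDehomogenization {z : CoordRing K n} (hz : z.IsHomogeneous 1) (hz0 : z ≠ 0) :
    ∃ π : CoordRing K n →ₐ[K] MvPolynomial (Fin n) K, IsDehomogenization z π := by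
  let L : (Fin (n + 1) → K) →ₗ[K] CoordRing K n := Fintype.linearCombination K X
  have hL1 (v : Fin (n + 1) → K) : (L v).IsHomogeneous 1 := by
    rw [Fintype.linearCombination_apply]
    exact IsHomogeneous.sum _ _ _ fun i _ =>
      (homogeneousSubmodule _ K 1).smul_mem _ (isHomogeneous_X K i)
  have hLs (i : Fin (n + 1)) : L (Pi.single i 1) = X i := by
    simp [L]
  obtain ⟨a, rfl⟩ : ∃ a, L a = z := by
    have : z ∈ Submodule.span K (Set.range X) := by
      rw [← homogeneousSubmodule_one_eq_span_X]
      exact hz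
    rwa [← Fintype.range_linearCombination] at this
  have ha : a ≠ 0 := by
    rintro rfl
    exact hz0 (map_zero L)
  obtain ⟨A, hA⟩ := exists_linearEquiv_apply_eq (K := K) ha
    (show (Pi.single 0 1 : Fin (n + 1) → K) ≠ 0 by simp)
  let T (B : (Fin (n + 1) → K) ≃ₗ[K] (Fin (n + 1) → K)) : CoordRing K n →ₐ[K] CoordRing K n :=
    aeval fun i => L (B (Pi.single i 1))
  have hT (B : (Fin (n + 1) → K) ≃ₗ[K] (Fin (n + 1) → K)) (v : Fin (n + 1) → K) :
      T B (L v) = L (B v) := by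
    have : (T B).toLinearMap ∘ₗ L = L ∘ₗ B.toLinearMap := by
      refine LinearMap.pi_ext' fun i => LinearMap.ext_ring ?_
      simp only [LinearMap.comp_apply, LinearMap.single_apply, hLs, AlgHom.toLinearMap_apply]
      simp [T]
    exact congrArg (· v) this
  let φ : CoordRing K n ≃ₐ[K] CoordRing K n := AlgEquiv.ofAlgHom (T A) (T A.symm)
    (MvPolynomial.algHom_ext fun i => by
      rw [AlgHom.comp_apply, ← hLs, hT, hT, A.apply_symm_apply]; rfl)
    (MvPolynomial.algHom_ext fun i => by
      rw [AlgHom.comp_apply, ← hLs, hT, hT, A.symm_apply_apply]; rfl)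
  refine ⟨(dehomogenizeZero K n).comp φ.toAlgHom, φ, fun i => ?_, ?_, rfl⟩
  · rw [← hLs]
    exact (hT A _).symm ▸ hL1 _
  · change T A (L a) = X 0
    rw [hT, hA, hLs]

/-- Over an infinite field, some linear form is a non-zero-divisor modulo a saturated ideal. -/
theorem exists_isSMulRegular_linear [Infinite K] {J : Ideal (CoordRing K n)}
    (hJ : IsSaturatedIdeal J) :
    ∃ z : CoordRing K n, z.IsHomogeneous 1 ∧ IsSMulRegular (CoordRing K n ⧸ J) z := by
  let V := homogeneousSubmodule (Fin (n + 1)) K 1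
  have := (associatedPrimes.finite (CoordRing K n) (CoordRing K n ⧸ J)).to_subtype
  let p (P : associatedPrimes (CoordRing K n) (CoordRing K n ⧸ J)) : Subspace K V :=
    (P.1.restrictScalars K).comap V.subtype
  by_contra! hcon
  -- Zero-divisors are the union of the finitely many associated primes. A vector space over an
  -- infinite field is not a finite union of proper subspaces, so one such prime contains every
  -- linear form.
  have hcov : ⋃ P, (p P : Set V) = Set.univ := by
    rw [Set.eq_univ_iff_forall]
    intro v
    have hv : v.1 ∈ ({r | IsSMulRegular (CoordRing K n ⧸ J) r}ᶜ : Set (CoordRing K n)) :=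
      hcon v.1 v.2
    rw [← biUnion_associatedPrimes_eq_compl_regular] at hv
    obtain ⟨P, hP, hvP⟩ := Set.mem_iUnion₂.1 hv
    exact Set.mem_iUnion.2 ⟨⟨P, hP⟩, hvP⟩
  obtain ⟨⟨P, hP⟩, htop⟩ := Subspace.exists_eq_top_of_iUnion_eq_univ hcov
  obtain ⟨hprime, x, hx⟩ := isAssociatedPrime_iff.1 hP
  obtain ⟨g, rfl⟩ := Ideal.Quotient.mk_surjective x
  have hmem (w : CoordRing K n) (hw : w.IsHomogeneous 1) : w ∈ P := by
    have : (⟨w, hw⟩ : V) ∈ p ⟨P, hP⟩ := htop ▸ Submodule.mem_top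
    exact this
  -- `P` annihilates the class of `g`, so `g * M ⊆ J` and saturation makes that class zero; its
  -- annihilator is then the whole ring, not a prime.
  have hg : g ∈ J := by
    refine hJ.2 g ⟨1, forall_mem_irrelevantIdeal_pow_iff.2 fun w hw => ?_⟩
    have hwP := hmem w hw
    rw [hx, Submodule.mem_colon_singleton, Submodule.mem_bot] at hwP
    rw [mul_comm]
    exact Ideal.Quotient.eq_zero_iff_mem.1 hwP
  refine hprime.ne_top ?_
  rw [hx, Ideal.Quotient.eq_zero_iff_mem.2 hg]
  simp

end Dehomogenization

end Inessential

/-! ### The equivalences. -/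

theorem proposition2p1 {K : Type*} [Field K] [IsAlgClosed K] (n : ℕ)
    (H : Ideal (Inessential.CoordRing K n)) (hH : Inessential.IsHomogeneousIdeal H)
    (hsat : Inessential.saturation H < Inessential.irrelevantIdeal K n)
    (f : Inessential.CoordRing K n) (hf : ∃ d : ℕ, f.IsHomogeneous d)
    (hfM : f ∈ Inessential.irrelevantIdeal K n)
    (I : Ideal (Inessential.CoordRing K n)) (hI : I = H ⊔ Ideal.span {f}) :
    List.TFAE
      [∃ t : ℕ, ∀ g ∈ Inessential.irrelevantIdeal K n ^ t, f * g ∈ H,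
       f ∈ Inessential.saturation H,
       ∃ P : Polynomial ℚ,
         Inessential.IsHilbertPolynomial I P ∧ Inessential.IsHilbertPolynomial H P,
       ∃ z : Inessential.CoordRing K n, z.IsHomogeneous 1 ∧ z ≠ 0 ∧
         IsSMulRegular (Inessential.CoordRing K n ⧸ Inessential.saturation H) z ∧
         ∃ π : Inessential.CoordRing K n →ₐ[K] MvPolynomial (Fin n) K,
           Inessential.IsDehomogenization z π ∧ H.map π = I.map π,
       ∀ z : Inessential.CoordRing K n, z.IsHomogeneous 1 → z ≠ 0 →
         ∀ π : Inessential.CoordRing K n →ₐ[K] MvPolynomial (Fin n) K,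
           Inessential.IsDehomogenization z π → H.map π = I.map π] := by
  obtain ⟨e, he⟩ := hf
  subst hI
  tfae_have 1 ↔ 2 := (Inessential.mem_saturation_iff hH).symm
  tfae_have 3 ↔ 1 := Inessential.exists_isHilbertPolynomial_iff hH he
  tfae_have 1 → 5 := by
    rintro ⟨t, ht⟩ z hz - π hπ
    rw [Ideal.map_sup, Ideal.map_span, Set.image_singleton, eq_comm, sup_eq_left,
      Ideal.span_singleton_le_iff_mem]
    have hzt : (z ^ t).IsHomogeneous t := by simpa using hz.pow t
    have := Ideal.mem_map_of_mem π
      (ht _ (Inessential.mem_irrelevantIdeal_pow_of_isHomogeneous hzt le_rfl))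
    rwa [map_mul, map_pow, hπ.map_eq_one, one_pow, mul_one] at this
  tfae_have 5 → 4 := by
    intro h
    obtain ⟨z, hz, hreg⟩ := Inessential.exists_isSMulRegular_linear
      (Inessential.isSaturatedIdeal_saturation hH)
    -- Zero would be regular on a zero quotient; properness of the saturation excludes this.
    have hz0 : z ≠ 0 := by
      rintro rfl
      have : Nontrivial (Inessential.CoordRing K n ⧸ Inessential.saturation H) :=
        Ideal.Quotient.nontrivial_iff.2 hsat.ne_top
      exact IsSMulRegular.not_zero hreg
    obtain ⟨π, hπ⟩ := Inessential.exists_isDehomogenization hz hz0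
    exact ⟨z, hz, hz0, hreg, π, hπ, h z hz hz0 π hπ⟩
  tfae_have 4 → 2 := by
    rintro ⟨z, hz, -, hreg, π, hπ, h⟩
    have hfH : π f ∈ H.map π := by
      rw [h]
      exact Ideal.mem_map_of_mem π (Ideal.mem_sup_right (Ideal.mem_span_singleton_self f))
    obtain ⟨k, hk⟩ := hπ.exists_pow_mul_mem hz hH he hfH
    refine Ideal.Quotient.eq_zero_iff_mem.1 (hreg.pow k ?_)
    change z ^ k • _ = z ^ k • _
    rw [smul_zero]
    exact Ideal.Quotient.eq_zero_iff_mem.2 (Inessential.le_saturation H hk)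
  tfae_finish
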